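/- Let $a,b,c,d$ be the automorphisms of the binary rooted tree $\{0,1\}^*$ (the set of finite words over $\{0,1\}$) that fix the empty word and satisfy, for every word $\sigma$ and every letter $x$, with $\overline x=1-x$: $a(x\sigma)=\overline x\sigma$; $b(0x\sigma)=0\overline x\sigma$, $b(1\sigma)=1c(\sigma)$; $c(0x\sigma)=0\overline x\sigma$, $c(1\sigma)=1d(\sigma)$; $d(0x\sigma)=0x\sigma$, $d(1\sigma)=1b(\sigma)$; and $b(0)=c(0)=d(0)=0$. Let $\mathfrak G=\langle a,b,c,d\rangle$ be Grigorchuk's group. A finite set $S\subset\mathfrak G$ is a semigroup generating system if every $g\in\mathfrak G$ is a product $s_1\cdots s_n$ with $n\ge0$ and all $s_i\in S$; then let $|g|_S$ be the least such $n$ and $\gamma^S_{\mathfrak G}(n)=\#\{g\in\mathfrak G:|g|_S\le n\}$. For functions $f,g$ on $[0,\infty)$ write $f\precsim g$ if there is a constant $C>0$ with $f(x)\le C+C\,g(Cx+C)$ for all $x\ge0$; a sequence $\{a_n\}_{n\ge 0}$ is regarded as the function $x\mapsto a_{\lfloor x\rfloor}$. **Theorem.** The polynomial $X^3+X^2+X-2$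 has exactly one real root $\eta$, and for every finite semigroup generating system $S$ of $\mathfrak G$ the growth function $\gamma=\gamma^S_{\mathfrak G}$ satisfies $$e^{\sqrt x}\;\precsim\;\gamma\;\precsim\; e^{x^{1/(1-\log_2\eta)}}.$$ -/

import Mathlib

namespace GrigorchukGrowth

/-! Asymptotic comparison of functions and sequences -/

/-- `f ≾ g` for functions on the nonnegative reals: there is a constant `C > 0` with
`f x ≤ C + C * g (C * x + C)` for all `x ≥ 0`.  Functions are written with domain `ℝ`, but only
their values on `[0, ∞)` matter, since `C * x + C ≥ 0`. -/
def Precsim (f g : ℝ → ℝ) : Prop :=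
  ∃ C : ℝ, 0 < C ∧ ∀ x : ℝ, 0 ≤ x → f x ≤ C + C * g (C * x + C)

/-- The function `x ↦ a ⌊x⌋` on the nonnegative reals defined by a sequence `a`. -/
noncomputable def ofSeq (a : ℕ → ℕ) : ℝ → ℝ := fun x => (a ⌊x⌋₊ : ℝ)

/-! Growth of groups -/

section Growth

variable {G : Type*} [Group G]

/-- `S` is a semigroup generating system: every element of `G` is a product `s₁ ⋯ sₙ` of elements
of `S` (no inverses). -/
def IsGenSystem (S : Set G) : Prop :=
  ∀ g : G, ∃ l : List G, (∀ s ∈ l, s ∈ S) ∧ l.prod = g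

/-- The word length `|g|`: the least number of elements of `S` needed to write `g` as a product
(the empty product is allowed, so `|1| = 0`). -/
noncomputable def wordLength (S : Set G) (g : G) : ℕ :=
  sInf {n : ℕ | ∃ l : List G, (∀ s ∈ l, s ∈ S) ∧ l.length = n ∧ l.prod = g}

/-- The growth function `γ_G^S(n) = #{g ∈ G : |g| ≤ n}`. -/
noncomputable def growth (S : Set G) (n : ℕ) : ℕ :=
  Nat.card {g : G // wordLength S g ≤ n}

end Growth

/-! Grigorchuk's group acting on the binary rooted tree.  A vertex is a finite word over
`{0, 1}`, with `0` written `false` and `1` written `true`. -/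

/-- `a (x σ) = x̄ σ`. -/
def aFun : List Bool → List Bool
  | [] => []
  | x :: σ => (!x) :: σ

/-- The names of the three generators `b`, `c`, `d`. -/
inductive Letter
  | b
  | c
  | d

/-- The maps `b`, `c`, `d`, defined by simultaneous recursion:
`b (0 x σ) = 0 x̄ σ`, `b (1 σ) = 1 c(σ)`;
`c (0 x σ) = 0 x̄ σ`, `c (1 σ) = 1 d(σ)`;
`d (0 x σ) = 0 x σ`, `d (1 σ) = 1 b(σ)`. -/
def act : Letter → List Bool → List Bool
  | _, [] => []
  | .b, false :: σ => false :: aFun σ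
  | .b, true :: σ => true :: act .c σ
  | .c, false :: σ => false :: aFun σ
  | .c, true :: σ => true :: act .d σ
  | .d, false :: σ => false :: σ
  | .d, true :: σ => true :: act .b σ

theorem aFun_aFun (w : List Bool) : aFun (aFun w) = w := by
  cases w <;> simp [aFun]

theorem act_act (t : Letter) (w : List Bool) : act t (act t w) = w := by
  induction w generalizing t with
  | nil => simp [act]
  | cons x σ ih => cases t <;> cases x <;> simp [act, aFun_aFun, ih]

/-- The generator `a` as a permutation of the vertices of the tree. -/
def genA : Equiv.Perm (List Bool) := Function.Involutive.toPerm aFun aFun_aFun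

/-- The generator `b` as a permutation of the vertices of the tree. -/
def genB : Equiv.Perm (List Bool) :=
  Function.Involutive.toPerm (act .b) (act_act .b)

/-- The generator `c` as a permutation of the vertices of the tree. -/
def genC : Equiv.Perm (List Bool) :=
  Function.Involutive.toPerm (act .c) (act_act .c)

/-- The generator `d` as a permutation of the vertices of the tree. -/
def genD : Equiv.Perm (List Bool) :=
  Function.Involutive.toPerm (act .d) (act_act .d)

/-- Grigorchuk's group `⟨a, b, c, d⟩`.  The four generators preserve length and prefixes of words,
so this is a group of automorphisms of the binary rooted tree. -/
def grigorchukGroup : Subgroup (Equiv.Perm (List Bool)) :=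
  Subgroup.closure {genA, genB, genC, genD}

end GrigorchukGrowth

namespace GrigorchukGrowth

open Equiv

/-! ### Decomposition of tree automorphisms -/

/-! Both bounds come from the self-similarity g = (g₀, g₁) or (g₀, g₁)a, with b = (a, c), c = (a,
d), d = (1, b).

Upper bound: η is tuned so that the weights 1 - η³, η³, 1 - η², 1 - η of a, b, c, d satisfy the
triangle inequality on {1, b, c, d}, and so that passing to the two sections multiplies total weight
by η, up to an additive constant (`section_weight`, `exists_pair_of_mem_weightBall`). Decomposing an
element of weight w until all pieces lie in a fixed finite ball gives a binary tree. Concavity of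
the power function and 2(η/2)^β = 1, for β = 1/(1 - log₂ η), bound its size by a multiple of (w +
1)^β. The tree determines the element and is written as a word over a finite alphabet, so a ball of
radius w has at most exp(O((w + 1)^β)) elements.

Lower bound: each g with k letters a is the second section of some (δ, g) with at most 2k letters a,
where δ lies in the dihedral group ⟨a, d⟩ of order 8 (`exists_pair_mem_altBall`). Multiplying such
an element by the a-conjugate of another places two arbitrary elements, up to 64 choices, in the two
sections. So the ball size B satisfies B(k)² ≤ 64 B(4k + 2) (`ncard_altBall_sq_le`). Squaring while
the radius grows fourfold gives exp √k, provided some ball has more than 64 elements, which holds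
because the group is infinite.

Finally, lengths for any finite generating system are comparable with weights and with the number of
letters a. -/

/-- The permutation of the tree fixing the first letter and acting by `g₀` below `0` and by `g₁`
below `1`. -/
def pairFun (g₀ g₁ : List Bool → List Bool) : List Bool → List Bool
  | [] => []
  | false :: σ => false :: g₀ σ
  | true :: σ => true :: g₁ σ

/-- `pairFun` as a permutation. -/
def pair (g₀ g₁ : Perm (List Bool)) : Perm (List Bool) where
  toFun := pairFun g₀ g₁
  invFun := pairFun g₀.symm g₁.symm
  left_inv w := by rcases w with _ | ⟨_ | _, σ⟩ <;> simp [pairFun]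
  right_inv w := by rcases w with _ | ⟨_ | _, σ⟩ <;> simp [pairFun]

theorem pair_apply (g₀ g₁ : Perm (List Bool)) (w : List Bool) :
    pair g₀ g₁ w = pairFun g₀ g₁ w := rfl

theorem pair_mul (g₀ g₁ h₀ h₁ : Perm (List Bool)) :
    pair g₀ g₁ * pair h₀ h₁ = pair (g₀ * h₀) (g₁ * h₁) := by
  ext1 w
  rcases w with _ | ⟨_ | _, σ⟩ <;> simp [pair_apply, pairFun]

theorem pair_one : pair 1 1 = 1 := by
  ext1 w
  rcases w with _ | ⟨_ | _, σ⟩ <;> simp [pair_apply, pairFun]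

theorem pair_inj {g₀ g₁ h₀ h₁ : Perm (List Bool)} (h : pair g₀ g₁ = pair h₀ h₁) :
    g₀ = h₀ ∧ g₁ = h₁ := by
  constructor
  · ext1 w
    simpa [pair_apply, pairFun] using congrArg (fun f : Perm (List Bool) => f (false :: w)) h
  · ext1 w
    simpa [pair_apply, pairFun] using congrArg (fun f : Perm (List Bool) => f (true :: w)) h

theorem genA_apply (w : List Bool) : genA w = aFun w := rfl

theorem genA_mul_pair (g₀ g₁ : Perm (List Bool)) : genA * pair g₀ g₁ = pair g₁ g₀ * genA := by
  ext1 w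
  rcases w with _ | ⟨_ | _, σ⟩ <;> simp [pair_apply, pairFun, genA_apply, aFun]

theorem genA_mul_genA : genA * genA = 1 := by
  ext1 w
  simp [genA_apply, aFun_aFun]

/-- The elements of the Klein group `{1, b, c, d}`, with `1` named `none`. -/
def klein : Option Letter → Perm (List Bool)
  | none => 1
  | some t => Function.Involutive.toPerm (act t) (act_act t)

theorem klein_some_apply (t : Letter) (w : List Bool) : klein (some t) w = act t w := rfl

theorem klein_mul_self (v : Option Letter) : klein v * klein v = 1 := by
  ext1 w
  cases v
  · simp [klein]
  · simp [klein_some_apply, act_act]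

/-- `a` if the argument is `true`, and the identity otherwise. -/
def aPow : Bool → Perm (List Bool)
  | false => 1
  | true => genA

theorem genA_mul_aPow (e : Bool) : genA * aPow e = aPow !e := by
  cases e <;> simp [aPow, genA_mul_genA]

/-- Whether the section of an element of the Klein group at `0` is `a`. -/
def leftSection : Option Letter → Bool
  | some .b => true
  | some .c => true
  | _ => false

/-- The section of an element of the Klein group at `1`. -/
def rightSection : Option Letter → Option Letter
  | none => none
  | some .b => some .c
  | some .c => some .d
  | some .d => some .b

theorem klein_eq_pair (v : Option Letter) :
    klein v = pair (aPow (leftSection v)) (klein (rightSection v)) := by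
  rcases v with _ | v
  · simp [leftSection, rightSection, aPow, klein, pair_one]
  · ext1 w
    rcases v with _ | _ | _ <;> rcases w with _ | ⟨_ | _, σ⟩ <;>
      simp [leftSection, rightSection, aPow, klein_some_apply, pair_apply, pairFun, act, genA_apply]

theorem act_act_cyclic (w : List Bool) :
    act .b (act .c w) = act .d w ∧ act .c (act .d w) = act .b w ∧ act .d (act .b w) = act .c w := by
  induction w with
  | nil => simp [act]
  | cons x σ ih => cases x <;> simp [act, ih, aFun_aFun]

theorem act_comm (s t : Letter) (w : List Bool) : act s (act t w) = act t (act s w) := by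
  induction w generalizing s t with
  | nil => simp [act]
  | cons x σ ih => cases s <;> cases t <;> cases x <;> simp [act, ih]

instance : Finite Letter :=
  Finite.of_surjective
    (fun o : Option Bool => match o with
      | none => Letter.b
      | some false => Letter.c
      | some true => Letter.d)
    (by rintro (_ | _ | _); exacts [⟨none, rfl⟩, ⟨some false, rfl⟩, ⟨some true, rfl⟩])

/-! ### Alternating products -/

/-- The alternating product `v a u₁ a u₂ ⋯ a uₖ`. -/
def altProd (v : Option Letter) : List (Option Letter) → Perm (List Bool)
  | [] => klein v
  | u :: l => klein v * (genA * altProd u l)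

/-- The weights of `1, b, c, d`. -/
def kleinWeight (η : ℝ) : Option Letter → ℝ
  | none => 0
  | some .b => η ^ 3
  | some .c => 1 - η ^ 2
  | some .d => 1 - η

/-- The weight of an alternating product. -/
def altWeight (η : ℝ) (v : Option Letter) : List (Option Letter) → ℝ
  | [] => kleinWeight η v
  | u :: l => kleinWeight η v + (1 - η ^ 3 + altWeight η u l)

/-- The equation for η says exactly that the weight of b is the sum of those of c and d; the other
triangle inequalities then follow from positivity. -/
theorem klein_mul (η : ℝ) (h0 : 0 < η) (h1 : η < 1) (h : η ^ 3 + η ^ 2 + η - 2 = 0)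
    (u v : Option Letter) : ∃ t, klein u * klein v = klein t ∧
      kleinWeight η t ≤ kleinWeight η u + kleinWeight η v := by
  have hw : η ^ 2 < η := by nlinarith
  have hw' : 0 < η ^ 3 := by positivity
  have key : ∀ r s t : Letter, (∀ w, act r (act s w) = act t w) →
      klein (some r) * klein (some s) = klein (some t) := fun r s t H => by
    ext1 w; simp [klein_some_apply, H]
  have B := fun w => (act_act_cyclic w).1
  have C := fun w => (act_act_cyclic w).2.1
  have D := fun w => (act_act_cyclic w).2.2
  have B' := fun w => (act_comm .c .b w).trans (B w)
  have C' := fun w => (act_comm .d .c w).trans (C w)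
  have D' := fun w => (act_comm .b .d w).trans (D w)
  rcases u with _ | u
  · exact ⟨v, by simp [klein], by simp [kleinWeight]⟩
  rcases v with _ | v
  · exact ⟨some u, by simp [klein], by simp [kleinWeight]⟩
  rcases u with _ | _ | _ <;> rcases v with _ | _ | _
  · exact ⟨none, klein_mul_self _, by simp only [kleinWeight]; linarith⟩
  · exact ⟨_, key _ _ _ B, by simp only [kleinWeight]; linarith⟩
  · exact ⟨_, key _ _ _ D', by simp only [kleinWeight]; linarith⟩
  · exact ⟨_, key _ _ _ B', by simp only [kleinWeight]; linarith⟩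
  · exact ⟨none, klein_mul_self _, by simp only [kleinWeight]; linarith⟩
  · exact ⟨_, key _ _ _ C, by simp only [kleinWeight]; linarith⟩
  · exact ⟨_, key _ _ _ D, by simp only [kleinWeight]; linarith⟩
  · exact ⟨_, key _ _ _ C', by simp only [kleinWeight]; linarith⟩
  · exact ⟨none, klein_mul_self _, by simp only [kleinWeight]; linarith⟩

/-! ### The root η, weights and balls -/

/-- The root of `X³ + X² + X - 2`, with the bounds that are used. -/
structure IsEta (η : ℝ) : Prop where
  pos : 0 < η
  lt_one : η < 1
  eq : η ^ 3 + η ^ 2 + η - 2 = 0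

theorem exists_isEta : ∃ η : ℝ, IsEta η := by
  have hc : ContinuousOn (fun x : ℝ => x ^ 3 + x ^ 2 + x - 2) (Set.Icc 0 1) := by fun_prop
  obtain ⟨η, hη, h⟩ := intermediate_value_Ioo (zero_le_one' ℝ) hc
    (show (0 : ℝ) ∈ _ by norm_num)
  exact ⟨η, hη.1, hη.2, h⟩

theorem IsEta.root_iff {η : ℝ} (h : IsEta η) (x : ℝ) : x ^ 3 + x ^ 2 + x - 2 = 0 ↔ x = η := by
  refine ⟨fun hx => ?_, fun hx => hx ▸ h.eq⟩
  have h1 : (x - η) * (x ^ 2 + x * η + η ^ 2 + x + η + 1) = 0 := by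
    linear_combination hx - h.eq
  rcases mul_eq_zero.1 h1 with h2 | h2
  · linarith
  -- Twice the quadratic factor is (x + η + 1)² + x² + η² + 1 > 0.
  · nlinarith [sq_nonneg (x + η + 1), sq_nonneg x, sq_nonneg η, h.pos]

theorem kleinWeight_nonneg {η : ℝ} (h : IsEta η) (v : Option Letter) : 0 ≤ kleinWeight η v := by
  have h0 := h.pos
  have h1 := h.lt_one
  have h3 := h.eq
  rcases v with _ | _ | _ | _ <;> simp only [kleinWeight]
  · rfl
  · positivity
  · nlinarith
  · linarith

theorem IsEta.weightA_pos {η : ℝ} (h : IsEta η) : 0 < 1 - η ^ 3 := by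
  have := pow_lt_one₀ h.pos.le h.lt_one (n := 3) (by norm_num)
  linarith

theorem altWeight_lower {η : ℝ} (h : IsEta η) (v : Option Letter) (l : List (Option Letter)) :
    (1 - η ^ 3) * l.length ≤ altWeight η v l := by
  induction l generalizing v with
  | nil => simpa [altWeight] using kleinWeight_nonneg h v
  | cons u l ih =>
    have := ih u
    have := kleinWeight_nonneg h v
    simp only [altWeight, List.length_cons]
    push_cast
    linarith

/-- The elements with an alternating expression of weight at most `w`. -/
def weightBall (η w : ℝ) : Set (Perm (List Bool)) :=
  {g | ∃ v l, altProd v l = g ∧ altWeight η v l ≤ w}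

/-- The elements with an alternating expression with at most `k` letters `a`. -/
def altBall (k : ℕ) : Set (Perm (List Bool)) :=
  {g | ∃ v l, altProd v l = g ∧ l.length ≤ k}

theorem altBall_finite (k : ℕ) : (altBall k).Finite := by
  have h := (Set.finite_univ (α := Option Letter)).prod (List.finite_length_le (Option Letter) k)
  refine (h.image fun p => altProd p.1 p.2).subset ?_
  rintro _ ⟨v, l, rfl, hl⟩
  exact ⟨(v, l), ⟨trivial, hl⟩, rfl⟩

theorem weightBall_finite {η : ℝ} (h : IsEta η) (w : ℝ) : (weightBall η w).Finite := by
  refine (altBall_finite ⌊w / (1 - η ^ 3)⌋₊).subset ?_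
  rintro _ ⟨v, l, rfl, hl⟩
  refine ⟨v, l, rfl, Nat.le_floor ?_⟩
  rw [le_div_iff₀ h.weightA_pos, mul_comm]
  exact (altWeight_lower h v l).trans hl

theorem weightBall_nonneg {η w : ℝ} (h : IsEta η) {g : Perm (List Bool)}
    (hg : g ∈ weightBall η w) : 0 ≤ w := by
  obtain ⟨v, l, -, hl⟩ := hg
  exact (mul_nonneg h.weightA_pos.le l.length.cast_nonneg).trans ((altWeight_lower h v l).trans hl)

theorem weightBall_mono {η w w' : ℝ} (h : w ≤ w') : weightBall η w ⊆ weightBall η w' := by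
  rintro g ⟨v, l, hg, hl⟩
  exact ⟨v, l, hg, hl.trans h⟩

theorem altBall_mono {k k' : ℕ} (h : k ≤ k') : altBall k ⊆ altBall k' := by
  rintro g ⟨v, l, hg, hl⟩
  exact ⟨v, l, hg, hl.trans h⟩

theorem one_mem_weightBall (η : ℝ) : 1 ∈ weightBall η 0 := ⟨none, [], rfl, le_rfl⟩

theorem genA_mul_mem_weightBall {η w : ℝ} {g : Perm (List Bool)} (hg : g ∈ weightBall η w) :
    genA * g ∈ weightBall η (1 - η ^ 3 + w) := by
  obtain ⟨v, l, rfl, hl⟩ := hg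
  exact ⟨none, v :: l, by simp [altProd, klein], by simpa [altWeight, kleinWeight] using hl⟩

theorem genA_mul_mem_altBall {k : ℕ} {g : Perm (List Bool)} (hg : g ∈ altBall k) :
    genA * g ∈ altBall (k + 1) := by
  obtain ⟨v, l, rfl, hl⟩ := hg
  exact ⟨none, v :: l, by simp [altProd, klein], by simpa using hl⟩

theorem klein_mul_altProd {η : ℝ} (h : IsEta η) (u v : Option Letter) (l : List (Option Letter)) :
    ∃ t, klein u * altProd v l = altProd t l ∧
      altWeight η t l ≤ kleinWeight η u + altWeight η v l := by
  obtain ⟨t, ht, hw⟩ := klein_mul η h.pos h.lt_one h.eq u v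
  refine ⟨t, ?_, ?_⟩
  · cases l <;> simp [altProd, ← ht, mul_assoc]
  · cases l <;> simp only [altWeight] <;> linarith

theorem klein_mul_mem_weightBall {η w : ℝ} (h : IsEta η) (u : Option Letter)
    {g : Perm (List Bool)} (hg : g ∈ weightBall η w) :
    klein u * g ∈ weightBall η (kleinWeight η u + w) := by
  obtain ⟨v, l, rfl, hl⟩ := hg
  obtain ⟨t, ht, hw⟩ := klein_mul_altProd h u v l
  exact ⟨t, l, ht.symm, by linarith⟩

theorem klein_mul_mem_altBall {k : ℕ} (u : Option Letter) {g : Perm (List Bool)}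
    (hg : g ∈ altBall k) : klein u * g ∈ altBall k := by
  obtain ⟨η, h⟩ := exists_isEta
  obtain ⟨v, l, rfl, hl⟩ := hg
  obtain ⟨t, ht, -⟩ := klein_mul_altProd h u v l
  exact ⟨t, l, ht.symm, hl⟩

theorem altBall_mul {k m : ℕ} {g h : Perm (List Bool)} (hg : g ∈ altBall k) (hh : h ∈ altBall m) :
    g * h ∈ altBall (k + m) := by
  obtain ⟨v, l, rfl, hl⟩ := hg
  refine altBall_mono (Nat.add_le_add_right hl m) ?_
  clear hl
  induction l generalizing v with
  | nil => simpa [altProd] using klein_mul_mem_altBall v hh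
  | cons u l ih =>
    have := klein_mul_mem_altBall v (genA_mul_mem_altBall (ih u))
    rw [altProd, mul_assoc, mul_assoc, List.length_cons, add_right_comm]
    exact this

/-! ### The contraction inequality -/

/-- The weight of `aPow`. -/
def aWeight (η : ℝ) : Bool → ℝ
  | false => 0
  | true => 1 - η ^ 3

theorem aPow_mul_mem_weightBall {η w : ℝ} (e : Bool) {g : Perm (List Bool)}
    (hg : g ∈ weightBall η w) : aPow e * g ∈ weightBall η (aWeight η e + w) := by
  cases e
  · simpa [aPow, aWeight] using hg
  · exact genA_mul_mem_weightBall hg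

/-- The identity that dictates the weights: a syllable formed by v and one letter a has weight η⁰,
η, η² for v = b, c, d, and the sections of v have total weight η, η², η³. For v = 1 the inequality
is trivial. -/
theorem section_weight {η : ℝ} (h : IsEta η) (v : Option Letter) :
    aWeight η (leftSection v) + kleinWeight η (rightSection v) ≤
      η * (1 - η ^ 3 + kleinWeight η v) := by
  have h3 := h.eq
  have h5 := mul_nonneg h.pos.le h.weightA_pos.le
  rcases v with _ | _ | _ | _ <;>
    simp only [leftSection, rightSection, aWeight, kleinWeight]
  · linarith
  · linarith
  · linarith [show η * (1 - η ^ 3 + (1 - η ^ 2)) = η ^ 2 by linear_combination (-η) * h3]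
  · linarith [show η * (1 - η ^ 3 + (1 - η)) = η ^ 3 by linear_combination (-η) * h3]

/-- Apply `section_weight` to each syllable; a letter a only swaps the two sections. There is one
Klein letter more than there are letters a, whence the extra 1 - η³. -/
theorem exists_pair_of_mem_weightBall {η w : ℝ} (h : IsEta η) {g : Perm (List Bool)}
    (hg : g ∈ weightBall η w) :
    ∃ e g₀ g₁ w₀ w₁, g = pair g₀ g₁ * aPow e ∧ g₀ ∈ weightBall η w₀ ∧ g₁ ∈ weightBall η w₁ ∧
      w₀ + w₁ ≤ η * (1 - η ^ 3 + w) := by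
  obtain ⟨v, l, rfl, hl⟩ := hg
  suffices H : ∃ e g₀ g₁ w₀ w₁, altProd v l = pair g₀ g₁ * aPow e ∧ g₀ ∈ weightBall η w₀ ∧
      g₁ ∈ weightBall η w₁ ∧ w₀ + w₁ ≤ η * (1 - η ^ 3 + altWeight η v l) by
    obtain ⟨e, g₀, g₁, w₀, w₁, h1, h2, h3, h4⟩ := H
    exact ⟨e, g₀, g₁, w₀, w₁, h1, h2, h3, h4.trans
      (mul_le_mul_of_nonneg_left (by linarith) h.pos.le)⟩
  clear hl
  induction l generalizing v with
  | nil =>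
    have h0 := aPow_mul_mem_weightBall (leftSection v) (one_mem_weightBall η)
    have h1 := klein_mul_mem_weightBall h (rightSection v) (one_mem_weightBall η)
    rw [add_zero, mul_one] at h0 h1
    refine ⟨false, _, _, _, _, ?_, h0, h1, section_weight h v⟩
    rw [altProd, klein_eq_pair v]
    simp [aPow]
  | cons u l ih =>
    obtain ⟨e, g₀, g₁, w₀, w₁, h1, h2, h3, h4⟩ := ih u
    refine ⟨!e, _, _, _, _, ?_, aPow_mul_mem_weightBall (leftSection v) h3,
      klein_mul_mem_weightBall h (rightSection v) h2, ?_⟩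
    · rw [altProd, h1, ← genA_mul_aPow, ← mul_assoc genA, genA_mul_pair, ← pair_mul,
        ← klein_eq_pair]
      simp only [mul_assoc]
    · have := section_weight h v
      simp only [altWeight]
      linarith

/-! ### Encoding elements by words over a finite alphabet -/

/-- Instructions of a stack machine that computes tree automorphisms. -/
inductive Instr (X : Type)
  | skip
  | push (x : X)
  | node (e : Bool)

instance {X : Type} [Finite X] : Finite (Instr X) :=
  Finite.of_surjective
    (fun o : Option (X ⊕ Bool) => match o with
      | none => Instr.skip
      | some (.inl x) => Instr.push x
      | some (.inr e) => Instr.node e)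
    (by rintro (_ | x | e); exacts [⟨none, rfl⟩, ⟨some (.inl x), rfl⟩, ⟨some (.inr e), rfl⟩])

/-- The effect of an instruction on the stack. -/
def Instr.run {X : Type} (f : X → Perm (List Bool)) :
    List (Perm (List Bool)) → Instr X → List (Perm (List Bool))
  | st, .skip => st
  | st, .push x => f x :: st
  | g₁ :: g₀ :: st, .node e => (pair g₀ g₁ * aPow e) :: st
  | st, .node _ => st

/-- The program `p` computes `g`. -/
def Computes {X : Type} (f : X → Perm (List Bool)) (p : List (Instr X)) (g : Perm (List Bool)) :
    Prop :=
  ∀ st, p.foldl (Instr.run f) st = g :: st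

/-- Padding with `skip` makes every program have length exactly n, and a program determines the
element it computes. -/
theorem ncard_computable_le {X : Type} [Finite X] (f : X → Perm (List Bool)) (n : ℕ) :
    {g | ∃ p, p.length ≤ n ∧ Computes f p g}.Finite ∧
    {g | ∃ p, p.length ≤ n ∧ Computes f p g}.ncard ≤ Nat.card (Instr X) ^ n := by
  set T := {g | ∃ p, p.length ≤ n ∧ Computes f p g}
  let F : (Fin n → Instr X) → Perm (List Bool) :=
    fun p => ((List.ofFn p).foldl (Instr.run f) []).headD 1
  have hT : T ⊆ Set.range F := by
    rintro g ⟨p, hp, hg⟩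
    have hlen : (p ++ List.replicate (n - p.length) Instr.skip).length = n := by
      simp; omega
    have hskip : ∀ m st, (List.replicate m (Instr.skip : Instr X)).foldl (Instr.run f) st = st := by
      intro m
      induction m with
      | zero => simp
      | succ m ih => intro st; simp [List.replicate_succ, Instr.run, ih]
    refine ⟨fun i => (p ++ List.replicate (n - p.length) Instr.skip).get (i.cast hlen.symm), ?_⟩
    have : List.ofFn (fun i : Fin n =>
        (p ++ List.replicate (n - p.length) Instr.skip).get (i.cast hlen.symm)) =
        p ++ List.replicate (n - p.length) Instr.skip := by
      apply List.ext_get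
      · simp; omega
      · intros; simp
    simp only [F]
    rw [this, List.foldl_append, hskip, hg]
    rfl
  have hfin : (Set.range F).Finite := Set.finite_range F
  refine ⟨hfin.subset hT, (Set.ncard_le_ncard hT hfin).trans ?_⟩
  rw [← Set.image_univ]
  refine (Set.ncard_image_le).trans ?_
  rw [Set.ncard_univ, Nat.card_fun, Nat.card_fin]

/-! ### The growth exponent and the size of the encoding -/

theorem rpow_add_rpow_le {β x y : ℝ} (h0 : 0 ≤ β) (h1 : β ≤ 1) (hx : 0 ≤ x) (hy : 0 ≤ y) :
    x ^ β + y ^ β ≤ 2 * ((x + y) / 2) ^ β := by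
  have := (Real.concaveOn_rpow h0 h1).2 (Set.mem_Ici.2 hx) (Set.mem_Ici.2 hy)
    (show (0 : ℝ) ≤ 1 / 2 by norm_num) (show (0 : ℝ) ≤ 1 / 2 by norm_num) (by norm_num)
  simp only [smul_eq_mul] at this
  rw [show 1 / 2 * x + 1 / 2 * y = (x + y) / 2 by ring] at this
  linarith

/-- The growth exponent of the upper bound. -/
noncomputable def growthExponent (η : ℝ) : ℝ := 1 / (1 - Real.logb 2 η)

theorem growthExponent_mem {η : ℝ} (h : IsEta η) :
    0 < growthExponent η ∧ growthExponent η < 1 := by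
  have hl : Real.logb 2 η < 0 := Real.logb_neg (by norm_num) h.pos h.lt_one
  exact ⟨one_div_pos.2 (by linarith), (div_lt_one (by linarith)).2 (by linarith)⟩

/-- This equation defines the exponent: two halves, each shrunk by η/2, exactly balance. -/
theorem half_rpow_growthExponent {η : ℝ} (h : IsEta η) :
    2 * (η / 2) ^ growthExponent η = 1 := by
  have hl : Real.logb 2 η < 0 := Real.logb_neg (by norm_num) h.pos h.lt_one
  have h2 : η / 2 = 2 ^ (Real.logb 2 η - 1) := by
    rw [Real.rpow_sub (by norm_num), Real.rpow_logb (by norm_num) (by norm_num) h.pos,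
      Real.rpow_one]
  rw [h2, ← Real.rpow_mul (by norm_num),
    show (Real.logb 2 η - 1) * growthExponent η = -1 by
      rw [growthExponent]; field_simp [show 1 - Real.logb 2 η ≠ 0 by linarith]; ring]
  norm_num [Real.rpow_neg_one]

/-- The shift by s absorbs the additive constant of the contraction, and the maximum with 1 accounts
for leaves. `hs` serves the cases where at least one section is heavy, `hz` the case of two light
ones. -/
theorem max_rpow_add_le {η s x y z : ℝ} (h : IsEta η) (hs : 2 ≤ (1 - η) * s)
    (hz : 2 ≤ η * (z - s)) (hx0 : 0 ≤ x) (hy0 : 0 ≤ y) (hxy : x + y ≤ η * (1 - η ^ 3 + z)) :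
    (max (x - s) 1) ^ growthExponent η + (max (y - s) 1) ^ growthExponent η ≤
      (max (z - s) 1) ^ growthExponent η := by
  obtain ⟨hb0, hb1⟩ := growthExponent_mem h
  have h0 := h.pos
  have h1 := h.lt_one
  have hA := h.weightA_pos
  have h3 : η * (1 - η ^ 3) ≤ 1 := by
    have : 0 < η ^ 3 := by positivity
    nlinarith
  have hs0 : 0 < s := by
    by_contra hneg
    nlinarith
  have hsum : max (x - s) 1 + max (y - s) 1 ≤ η * (z - s) := by
    rcases max_cases (x - s) 1 with ⟨hx, -⟩ | ⟨hx, -⟩ <;>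
    rcases max_cases (y - s) 1 with ⟨hy, -⟩ | ⟨hy, -⟩ <;> rw [hx, hy] <;> nlinarith
  have hx1 : 1 ≤ max (x - s) 1 := le_max_right _ _
  have hy1 : 1 ≤ max (y - s) 1 := le_max_right _ _
  have hzs : 0 ≤ z - s := by
    by_contra hneg
    nlinarith
  calc _ ≤ 2 * ((max (x - s) 1 + max (y - s) 1) / 2) ^ growthExponent η :=
        rpow_add_rpow_le hb0.le hb1.le (by linarith) (by linarith)
    _ ≤ 2 * (η / 2 * (z - s)) ^ growthExponent η := by
        gcongr
        linarith
    _ = (z - s) ^ growthExponent η := by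
        rw [Real.mul_rpow (by positivity) hzs, ← mul_assoc, half_rpow_growthExponent h, one_mul]
    _ ≤ _ := Real.rpow_le_rpow hzs (le_max_left _ _) hb0.le

/-- Elements of weight at most K are leaves; others split into two sections. Counting length plus
one makes the cost additive at a node, and the factor 2 is the cost of a leaf. -/
theorem exists_computes {η s K : ℝ} (h : IsEta η) (hs : 2 ≤ (1 - η) * s)
    (hK : 2 ≤ η * (K - s)) (n : ℕ) (w : ℝ) (hw : w ≤ n) (g : Perm (List Bool))
    (hg : g ∈ weightBall η w) :
    ∃ p : List (Instr (weightBall η K)), (p.length : ℝ) + 1 ≤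
      2 * (max (w - s) 1) ^ growthExponent η ∧ Computes (fun x => x.1) p g := by
  have h0 := h.pos
  have h1 := h.lt_one
  obtain ⟨hb0, hb1⟩ := growthExponent_mem h
  have leaf : ∀ w, ∀ g ∈ weightBall η w, w ≤ K → ∃ p : List (Instr (weightBall η K)),
      (p.length : ℝ) + 1 ≤ 2 * (max (w - s) 1) ^ growthExponent η ∧
        Computes (fun x => x.1) p g := by
    intro w g hg hwK
    refine ⟨[.push ⟨g, weightBall_mono hwK hg⟩], ?_, fun st => rfl⟩
    have : 1 ≤ (max (w - s) 1) ^ growthExponent η :=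
      Real.one_le_rpow (le_max_right _ _) hb0.le
    simp only [List.length_singleton]
    push_cast
    linarith
  have hsK : s ≤ K := by
    by_contra hneg
    nlinarith
  have hs0 : 0 < s := by
    by_contra hneg
    nlinarith
  induction n generalizing w g with
  | zero => exact leaf w g hg (by simp at hw; linarith)
  | succ n ih =>
    rcases le_or_gt w K with hwK | hwK
    · exact leaf w g hg hwK
    obtain ⟨e, g₀, g₁, w₀, w₁, rfl, hg₀, hg₁, hsum⟩ := exists_pair_of_mem_weightBall h hg
    have hw₀ := weightBall_nonneg h hg₀
    have hw₁ := weightBall_nonneg h hg₁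
    have h3 : η * (1 - η ^ 3) ≤ 1 := by
      have : 0 < η ^ 3 := by positivity
      have := h.weightA_pos
      nlinarith
    push_cast at hw
    -- Since w > s, (1 - η)w ≥ 2, so both sections together weigh at most w - 1.
    have hlt : η * (1 - η ^ 3 + w) ≤ n := by nlinarith
    obtain ⟨p₀, hp₀, hc₀⟩ := ih w₀ (by linarith) g₀ hg₀
    obtain ⟨p₁, hp₁, hc₁⟩ := ih w₁ (by linarith) g₁ hg₁
    refine ⟨p₀ ++ p₁ ++ [.node e], ?_, fun st => ?_⟩
    · have := max_rpow_add_le h hs (z := w) (by nlinarith) hw₀ hw₁ hsum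
      simp only [List.length_append, List.length_singleton]
      push_cast
      linarith
    · rw [List.foldl_append, List.foldl_append, hc₀, hc₁]
      rfl

/-- The upper bound for the weighted growth. -/
theorem exists_ncard_weightBall_le {η : ℝ} (h : IsEta η) :
    ∃ c : ℝ, 0 < c ∧ ∀ w : ℝ, 0 ≤ w →
      ((weightBall η w).ncard : ℝ) ≤ Real.exp (c * (w + 1) ^ growthExponent η) := by
  have h0 := h.pos
  have h1 := h.lt_one
  have h1' : 0 < 1 - η := by linarith
  obtain ⟨hb0, hb1⟩ := growthExponent_mem h
  set s := 2 / (1 - η) with hs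
  -- The values of s and K turn the two hypotheses of `exists_computes` into equalities.
  set K := s + 2 / η with hK
  have hs2 : (1 - η) * s = 2 := by rw [hs]; field_simp
  have hK2 : η * (K - s) = 2 := by rw [hK]; field_simp; ring
  have : Finite (weightBall η K) := (weightBall_finite h K)
  set q := Nat.card (Instr (weightBall η K)) with hq
  have : Nonempty (Instr (weightBall η K)) := ⟨.skip⟩
  have hq1 : 1 ≤ q := Nat.card_pos
  have hq1' : (1 : ℝ) ≤ q := by exact_mod_cast hq1
  -- Only log q ≥ 0 is known here; the added 1 makes the constant positive.
  refine ⟨2 * Real.log q + 1, by have := Real.log_nonneg hq1'; positivity, fun w hw => ?_⟩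
  set B := 2 * (w + 1) ^ growthExponent η with hB
  have hB0 : 0 ≤ B := by positivity
  obtain ⟨hfin, hcard⟩ := ncard_computable_le (fun x : weightBall η K => x.1) ⌊B⌋₊
  have hs0 : 0 < s := by positivity
  have hsub : weightBall η w ⊆ {g | ∃ p, p.length ≤ ⌊B⌋₊ ∧
      Computes (fun x : weightBall η K => x.1) p g} := by
    intro g hg
    obtain ⟨p, hp, hc⟩ := exists_computes h hs2.ge hK2.ge ⌈w⌉₊ w (Nat.le_ceil w) g hg
    refine ⟨p, Nat.le_floor ?_, hc⟩
    have : (max (w - s) 1) ^ growthExponent η ≤ (w + 1) ^ growthExponent η :=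
      Real.rpow_le_rpow (by positivity) (max_le (by linarith) (by linarith)) hb0.le
    linarith
  have h2 : (weightBall η w).ncard ≤ q ^ ⌊B⌋₊ := (Set.ncard_le_ncard hsub hfin).trans hcard
  calc ((weightBall η w).ncard : ℝ) ≤ (q : ℝ) ^ ⌊B⌋₊ := by exact_mod_cast h2
    _ = Real.exp (Real.log q * ⌊B⌋₊) := by
        rw [mul_comm, Real.exp_nat_mul, Real.exp_log (by linarith)]
    _ ≤ _ := by
        apply Real.exp_le_exp.2
        have h3 := mul_le_mul_of_nonneg_left (Nat.floor_le hB0) (Real.log_nonneg hq1')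
        have : 0 ≤ (w + 1) ^ growthExponent η := by positivity
        rw [hB] at h3
        linarith

/-! ### The lower bound for alternating balls -/

/-- A set of representatives of the dihedral group generated by `a` and `d`. -/
def dihedralElt (p : Bool × Bool × Bool) : Perm (List Bool) :=
  pair (klein (if p.1 then some .b else none)) (klein (if p.2.1 then some .b else none)) *
    aPow p.2.2

theorem genA_mul_dihedralElt (p : Bool × Bool × Bool) :
    genA * dihedralElt p = dihedralElt (p.2.1, p.1, !p.2.2) := by
  simp only [dihedralElt]
  rw [← mul_assoc, genA_mul_pair, mul_assoc, genA_mul_aPow]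

theorem klein_d_mul_dihedralElt (p : Bool × Bool × Bool) :
    klein (some .d) * dihedralElt p = dihedralElt (p.1, !p.2.1, p.2.2) := by
  rcases p with ⟨x, y, e⟩
  simp only [dihedralElt]
  rw [klein_eq_pair, ← mul_assoc, pair_mul]
  have : ∀ y : Bool, klein (rightSection (some .d)) * klein (if y then some .b else none) =
      klein (if !y then some .b else none) := by
    rintro (_ | _)
    · simp [rightSection, klein]
    · exact klein_mul_self _
  rw [this]
  simp [leftSection, aPow]

/-- Lift g through the substitution a ↦ aca = (d, a), b ↦ d = (1, b), c ↦ b = (a, c), d ↦ c = (a,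
d). It doubles the number of letters a, and its first sections involve only a and d. -/
theorem exists_pair_mem_altBall {k : ℕ} {g : Perm (List Bool)} (hg : g ∈ altBall k) :
    ∃ p, pair (dihedralElt p) g ∈ altBall (2 * k) := by
  obtain ⟨v, l, rfl, hl⟩ := hg
  suffices H : ∃ p, pair (dihedralElt p) (altProd v l) ∈ altBall (2 * l.length) by
    obtain ⟨p, hp⟩ := H
    exact ⟨p, altBall_mono (by omega) hp⟩
  clear hl
  have kleinStep : ∀ (v : Option Letter) (m : ℕ) (q : Bool × Bool × Bool) (h : Perm (List Bool)),
      pair (dihedralElt q) h ∈ altBall m →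
      ∃ p, pair (dihedralElt p) (klein v * h) ∈ altBall m := by
    intro v m q h hq
    obtain ⟨u, rfl⟩ : ∃ u, rightSection u = v := by
      rcases v with _ | _ | _ | _
      exacts [⟨none, rfl⟩, ⟨some .d, rfl⟩, ⟨some .b, rfl⟩, ⟨some .c, rfl⟩]
    have h1 := klein_mul_mem_altBall u hq
    rw [klein_eq_pair u, pair_mul] at h1
    cases hu : leftSection u
    · rw [hu, aPow, one_mul] at h1
      exact ⟨_, h1⟩
    · rw [hu, aPow, genA_mul_dihedralElt] at h1
      exact ⟨_, h1⟩
  induction l generalizing v with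
  | nil =>
    obtain ⟨p, hp⟩ := kleinStep v 0 (false, false, false) 1
      ⟨none, [], by simp [altProd, dihedralElt, klein, aPow, pair_one], le_rfl⟩
    exact ⟨p, by simpa [altProd] using hp⟩
  | cons u l ih =>
    obtain ⟨q, hq⟩ := ih u
    have h1 := genA_mul_mem_altBall (klein_mul_mem_altBall (some .c) (genA_mul_mem_altBall hq))
    have h2 : genA * (klein (some .c) * (genA * pair (dihedralElt q) (altProd u l))) =
        pair (klein (some .d) * dihedralElt q) (genA * altProd u l) := by
      rw [klein_eq_pair (some .c), genA_mul_pair, ← mul_assoc (pair _ _), pair_mul, ← mul_assoc,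
        genA_mul_pair, mul_assoc, genA_mul_genA, mul_one]
      rfl
    rw [h2, klein_d_mul_dihedralElt] at h1
    exact kleinStep v _ _ _ h1

/-- Send (g, h) to (δ_g, g) · a(δ_h, h)a = (δ_g h, g δ_h). Together with δ_g and δ_h, for which
there are 8 · 8 indices, this recovers g and h. -/
theorem ncard_altBall_sq_le (k : ℕ) :
    (altBall k).ncard ^ 2 ≤ 64 * (altBall (4 * k + 2)).ncard := by
  choose δ hδ using fun g : altBall k => exists_pair_mem_altBall g.2
  have hmem : ∀ g h : altBall k, pair (dihedralElt (δ g) * h) (g * dihedralElt (δ h)) ∈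
      altBall (4 * k + 2) := by
    intro g h
    have h1 : pair (dihedralElt (δ g) * h) (g * dihedralElt (δ h)) =
        pair (dihedralElt (δ g)) g * (genA * (pair (dihedralElt (δ h)) h * genA)) := by
      rw [← genA_mul_pair, ← mul_assoc genA, genA_mul_genA, one_mul, pair_mul]
    rw [h1]
    have h2 : genA ∈ altBall 1 := ⟨none, [none], by simp [altProd, klein], le_rfl⟩
    exact altBall_mono (by omega) (altBall_mul (hδ g) (altBall_mul h2 (altBall_mul (hδ h) h2)))
  let F : altBall k × altBall k →
      ((Bool × Bool × Bool) × (Bool × Bool × Bool)) × altBall (4 * k + 2) :=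
    fun p => ((δ p.1, δ p.2), ⟨_, hmem p.1 p.2⟩)
  have hF : Function.Injective F := by
    rintro ⟨g, h⟩ ⟨g', h'⟩ H
    simp only [F, Prod.mk.injEq, Subtype.mk.injEq] at H
    obtain ⟨⟨h1, h2⟩, h3⟩ := H
    obtain ⟨h4, h5⟩ := pair_inj h3
    rw [h1] at h4
    rw [h2] at h5
    exact Prod.ext (Subtype.ext (mul_right_cancel h5)) (Subtype.ext (mul_left_cancel h4))
  have : Finite (altBall (4 * k + 2)) := altBall_finite _
  have := Nat.card_le_card_of_injective F hF
  rw [Nat.card_prod, Nat.card_prod, Nat.card_prod, Nat.card_prod, Nat.card_prod,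
    Nat.card_eq_two_iff.2 ⟨false, true, by simp, by ext x; cases x <;> simp⟩] at this
  rw [sq]
  exact this

/-! ### Expressing group elements by words, and infinitude -/

theorem genA_mem : genA ∈ grigorchukGroup := Subgroup.subset_closure (by simp)

theorem klein_mem (v : Option Letter) : klein v ∈ grigorchukGroup := by
  rcases v with _ | _ | _ | _
  · exact one_mem _
  all_goals exact Subgroup.subset_closure (by simp [klein, genB, genC, genD])

theorem altBall_subset (k : ℕ) : altBall k ⊆ grigorchukGroup := by
  rintro _ ⟨v, l, rfl, -⟩
  induction l generalizing v with
  | nil => exact klein_mem v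
  | cons u l ih => exact mul_mem (klein_mem v) (mul_mem genA_mem (ih u))

theorem mem_generators {x : Perm (List Bool)}
    (hx : x ∈ ({genA, genB, genC, genD} : Set (Perm (List Bool)))) :
    x = genA ∨ ∃ v, x = klein v := by
  rcases hx with rfl | rfl | rfl | rfl
  exacts [.inl rfl, .inr ⟨some .b, rfl⟩, .inr ⟨some .c, rfl⟩, .inr ⟨some .d, rfl⟩]

/-- Left multiplication by an element of the group changes weights by a bounded amount. -/
theorem exists_mul_mem_weightBall {η : ℝ} (h : IsEta η) {g : Perm (List Bool)}
    (hg : g ∈ grigorchukGroup) :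
    ∃ c : ℝ, ∀ w, ∀ x ∈ weightBall η w, g * x ∈ weightBall η (c + w) := by
  -- The generators are involutions, so they generate the group as a monoid.
  have hinv : ∀ x ∈ ({genA, genB, genC, genD} : Set (Perm (List Bool))), x⁻¹ = x := by
    intro x hx
    rcases mem_generators hx with rfl | ⟨v, rfl⟩
    · exact inv_eq_of_mul_eq_one_left genA_mul_genA
    · exact inv_eq_of_mul_eq_one_left (klein_mul_self v)
  rw [← SetLike.mem_coe, grigorchukGroup, ← Subgroup.coe_toSubmonoid,
    Subgroup.closure_toSubmonoid] at hg
  induction hg using Submonoid.closure_induction with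
  | mem x hx =>
    have hx' : x ∈ ({genA, genB, genC, genD} : Set (Perm (List Bool))) := by
      rcases hx with hx | hx
      · exact hx
      · have := hinv _ (Set.mem_inv.1 hx)
        rw [inv_inv] at this
        rw [this]
        exact hx
    rcases mem_generators hx' with rfl | ⟨v, rfl⟩
    · exact ⟨_, fun w x hx => genA_mul_mem_weightBall hx⟩
    · exact ⟨_, fun w x hx => klein_mul_mem_weightBall h v hx⟩
  | one => exact ⟨0, fun w x hx => by simpa using hx⟩
  | mul x y _ _ hx hy =>
    obtain ⟨c, hc⟩ := hx
    obtain ⟨c', hc'⟩ := hy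
    refine ⟨c + c', fun w z hz => ?_⟩
    rw [mul_assoc, add_assoc]
    exact hc _ _ (hc' _ _ hz)

theorem exists_mem_altBall {g : Perm (List Bool)} (hg : g ∈ grigorchukGroup) :
    ∃ k, g ∈ altBall k := by
  obtain ⟨η, h⟩ := exists_isEta
  obtain ⟨c, hc⟩ := exists_mul_mem_weightBall h hg
  obtain ⟨v, l, hvl, -⟩ := hc 0 1 (one_mem_weightBall η)
  exact ⟨l.length, v, l, by simpa using hvl, le_rfl⟩

/-- The map g ↦ (δ_g, g) is an injection of the group into itself that misses a, since its values
fix the first letter. -/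
theorem infinite_grigorchukGroup : Infinite grigorchukGroup := by
  by_contra hfin
  rw [not_infinite_iff_finite] at hfin
  have H : ∀ g : grigorchukGroup, ∃ p, pair (dihedralElt p) g ∈ grigorchukGroup := by
    intro g
    obtain ⟨k, hk⟩ := exists_mem_altBall g.2
    obtain ⟨p, hp⟩ := exists_pair_mem_altBall hk
    exact ⟨p, altBall_subset _ hp⟩
  choose δ hδ using H
  let F : grigorchukGroup → grigorchukGroup := fun g => ⟨_, hδ g⟩
  have hF : Function.Injective F := fun g h H =>
    Subtype.ext (pair_inj (congrArg Subtype.val H)).2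
  obtain ⟨g, hg⟩ := Finite.surjective_of_injective hF ⟨genA, genA_mem⟩
  have := congrArg (fun f : grigorchukGroup => (f : Perm (List Bool)) [false]) hg
  simp [F, pair_apply, pairFun, genA_apply, aFun] at this

theorem exists_lt_ncard_altBall (n : ℕ) : ∃ k, n < (altBall k).ncard := by
  have := infinite_grigorchukGroup
  obtain ⟨s, hs⟩ := Infinite.exists_subset_card_eq grigorchukGroup (n + 1)
  choose κ hκ using fun g : grigorchukGroup => exists_mem_altBall g.2
  refine ⟨s.sup κ, ?_⟩
  have h1 : Subtype.val '' (s : Set grigorchukGroup) ⊆ altBall (s.sup κ) := by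
    rintro _ ⟨g, hg, rfl⟩
    exact altBall_mono (Finset.le_sup hg) (hκ g)
  have h2 := Set.ncard_le_ncard h1 (altBall_finite _)
  rw [Set.ncard_image_of_injective _ Subtype.val_injective, Set.ncard_coe_finset, hs] at h2
  omega

/-- Iterating the quadratic inequality: the alternating balls grow at least like `exp √k`. -/
theorem exists_exp_le_ncard_altBall : ∃ (r : ℝ) (k₀ : ℕ), 0 < r ∧ ∀ i : ℕ,
    Real.exp (r * 2 ^ i) ≤ (altBall (4 ^ i * (k₀ + 1))).ncard := by
  obtain ⟨k₀, hk₀⟩ := exists_lt_ncard_altBall 64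
  have hk : (64 : ℝ) < (altBall k₀).ncard := by exact_mod_cast hk₀
  set q : ℝ := (altBall k₀).ncard / 64 with hq
  have hq1 : 1 < q := by rw [hq, lt_div_iff₀ (by norm_num)]; linarith
  refine ⟨Real.log q, k₀, Real.log_pos hq1, fun i => ?_⟩
  -- The shift k + 1 absorbs the constant in k ↦ 4k + 2, as (4k + 2) + 1 ≤ 4(k + 1); dividing ball
  -- sizes by 64 turns the quadratic inequality into plain squaring.
  have key : ∀ i : ℕ, ∃ k : ℕ, k + 1 ≤ 4 ^ i * (k₀ + 1) ∧
      64 * q ^ 2 ^ i ≤ (altBall k).ncard := by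
    intro i
    induction i with
    | zero => exact ⟨k₀, by simp, by rw [hq]; simp; linarith⟩
    | succ i ih =>
      obtain ⟨k, hk1, hk2⟩ := ih
      refine ⟨4 * k + 2, by rw [pow_succ]; linarith, ?_⟩
      have h1 : ((altBall k).ncard : ℝ) ^ 2 ≤ 64 * (altBall (4 * k + 2)).ncard := by
        exact_mod_cast ncard_altBall_sq_le k
      have h2 : (64 * q ^ 2 ^ i) ^ 2 ≤ ((altBall k).ncard : ℝ) ^ 2 := by gcongr
      rw [mul_pow, ← pow_mul, ← pow_succ] at h2
      linarith
  obtain ⟨k, hk1, hk2⟩ := key i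
  have h3 : (altBall k).ncard ≤ (altBall (4 ^ i * (k₀ + 1))).ncard :=
    Set.ncard_le_ncard (altBall_mono (by omega)) (altBall_finite _)
  have h4 : ((altBall k).ncard : ℝ) ≤ (altBall (4 ^ i * (k₀ + 1))).ncard := by exact_mod_cast h3
  have h5 : Real.exp (Real.log q * 2 ^ i) = q ^ 2 ^ i := by
    rw [mul_comm, show (2 : ℝ) ^ i = ((2 ^ i : ℕ) : ℝ) by push_cast; rfl, Real.exp_nat_mul,
      Real.exp_log (by linarith)]
  have h6 : 0 < q ^ 2 ^ i := by positivity
  rw [h5]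
  linarith

/-! ### Word length with respect to an arbitrary generating system -/

section WordLength

variable {G : Type*} [Group G] {S : Set G}

theorem wordLength_le {l : List G} (hl : ∀ s ∈ l, s ∈ S) : wordLength S l.prod ≤ l.length :=
  Nat.sInf_le ⟨l, hl, rfl, rfl⟩

theorem IsGenSystem.exists_list (hS : IsGenSystem S) (g : G) :
    ∃ l : List G, (∀ s ∈ l, s ∈ S) ∧ l.length = wordLength S g ∧ l.prod = g := by
  obtain ⟨l, hl, hg⟩ := hS g
  exact Nat.sInf_mem (s := {n : ℕ | ∃ l : List G, (∀ s ∈ l, s ∈ S) ∧ l.length = n ∧ l.prod = g})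
    ⟨l.length, l, hl, rfl, hg⟩

theorem IsGenSystem.wordLength_mul_le (hS : IsGenSystem S) (g h : G) :
    wordLength S (g * h) ≤ wordLength S g + wordLength S h := by
  obtain ⟨l, hl, hlen, rfl⟩ := hS.exists_list g
  obtain ⟨m, hm, hlen', rfl⟩ := hS.exists_list h
  rw [← hlen, ← hlen', ← List.prod_append, ← List.length_append]
  exact wordLength_le fun s hs => (List.mem_append.1 hs).elim (hl s) (hm s)

theorem IsGenSystem.finite_ball (hS : IsGenSystem S) (hfin : S.Finite) (n : ℕ) :
    {g : G | wordLength S g ≤ n}.Finite := by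
  have : Finite S := hfin
  refine ((List.finite_length_le S n).image fun l => (l.map Subtype.val).prod).subset ?_
  intro g hg
  obtain ⟨l, hl, hlen, rfl⟩ := hS.exists_list g
  refine ⟨l.attach.map fun x => ⟨x.1, hl _ x.2⟩, ?_, ?_⟩
  · simp only [Set.mem_ofPred_eq, List.length_map, List.length_attach]
    exact hlen.le.trans hg
  · simp [List.map_map, Function.comp_def]

theorem growth_mono (hS : IsGenSystem S) (hfin : S.Finite) : Monotone (growth S) := by
  intro m n hmn
  have : Finite {g : G // wordLength S g ≤ n} := hS.finite_ball hfin n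
  exact Nat.card_le_card_of_injective (fun g => ⟨g.1, g.2.trans hmn⟩)
    fun g h H => Subtype.ext (congrArg (fun x => x.1) H)

end WordLength

/-! ### Comparison of word length with weights and alternating length -/

theorem exists_growth_le {η : ℝ} {S : Set grigorchukGroup} (h : IsEta η) (hfin : S.Finite)
    (hS : IsGenSystem S) :
    ∃ M : ℝ, 0 < M ∧ ∀ n : ℕ, growth S n ≤ (weightBall η (M * n)).ncard := by
  choose c hc using fun g : grigorchukGroup => exists_mul_mem_weightBall h g.2
  obtain ⟨M, hM⟩ := (hfin.image c).bddAbove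
  refine ⟨max M 1, by positivity, fun n => ?_⟩
  have : Finite (weightBall η (max M 1 * n)) := weightBall_finite h _
  have key : ∀ l : List grigorchukGroup, (∀ s ∈ l, s ∈ S) →
      (l.prod : Perm (List Bool)) ∈ weightBall η (max M 1 * l.length) := by
    intro l hl
    induction l with
    | nil => simpa using one_mem_weightBall η
    | cons s l ih =>
      have h1 := hc s _ _ (ih fun t ht => hl t (List.mem_cons_of_mem _ ht))
      rw [List.prod_cons, Subgroup.coe_mul]
      refine weightBall_mono ?_ h1
      have : c s ≤ M := hM ⟨s, hl s List.mem_cons_self, rfl⟩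
      have := le_max_left M 1
      rw [List.length_cons]
      push_cast
      linarith
  refine Nat.card_le_card_of_injective (fun g => ⟨g.1.1, ?_⟩)
    fun g h H => Subtype.ext (Subtype.ext (congrArg (fun x => x.1) H))
  obtain ⟨l, hl, hlen, hg⟩ := hS.exists_list g.1
  rw [← hg]
  refine weightBall_mono ?_ (key l hl)
  have : (l.length : ℝ) ≤ n := by exact_mod_cast hlen.le.trans g.2
  gcongr

theorem exists_le_growth {S : Set grigorchukGroup} (hfin : S.Finite) (hS : IsGenSystem S) :
    ∃ M : ℕ, 0 < M ∧ ∀ k : ℕ, (altBall k).ncard ≤ growth S (M * (2 * k + 1)) := by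
  let A : grigorchukGroup := ⟨genA, genA_mem⟩
  let V : Option Letter → grigorchukGroup := fun v => ⟨klein v, klein_mem v⟩
  obtain ⟨M, hM⟩ := (Set.finite_range fun v => wordLength S (V v)).bddAbove
  refine ⟨M + wordLength S A + 1, by positivity, fun k => ?_⟩
  have : Finite {g : grigorchukGroup // wordLength S g ≤ (M + wordLength S A + 1) * (2 * k + 1)} :=
    hS.finite_ball hfin _
  have key : ∀ (l : List (Option Letter)) (v : Option Letter),
      wordLength S (⟨altProd v l, altBall_subset _ ⟨v, l, rfl, le_rfl⟩⟩ : grigorchukGroup) ≤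
        (M + wordLength S A + 1) * (2 * l.length + 1) := by
    intro l
    induction l with
    | nil =>
      intro v
      have : wordLength S (V v) ≤ M := hM ⟨v, rfl⟩
      simp only [List.length_nil]
      exact this.trans (by omega)
    | cons u l ih =>
      intro v
      have h1 : wordLength S (V v) ≤ M := hM ⟨v, rfl⟩
      have h2 := hS.wordLength_mul_le (V v) (A * ⟨altProd u l, altBall_subset _ ⟨u, l, rfl, le_rfl⟩⟩)
      have h3 := hS.wordLength_mul_le A ⟨altProd u l, altBall_subset _ ⟨u, l, rfl, le_rfl⟩⟩
      have h4 := ih u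
      refine h2.trans ?_
      rw [List.length_cons]
      linarith
  refine Nat.card_le_card_of_injective
    (fun g => ⟨⟨g.1, altBall_subset k g.2⟩, ?_⟩)
    fun g h H => Subtype.ext (congrArg (fun x => x.1.1) H)
  obtain ⟨g, v, l, rfl, hl⟩ := g
  refine (key l v).trans ?_
  gcongr

theorem precsim_growth {S : Set grigorchukGroup} (hfin : S.Finite) (hS : IsGenSystem S) :
    Precsim (fun x => Real.exp (Real.sqrt x)) (ofSeq (growth S)) := by
  obtain ⟨r, k₀, hr, hk⟩ := exists_exp_le_ncard_altBall
  obtain ⟨M, hM0, hM⟩ := exists_le_growth hfin hS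
  set A : ℕ := M * (2 * (k₀ + 1) + 1) with hA
  have hA0 : 1 ≤ A := Nat.one_le_iff_ne_zero.2 (by positivity)
  have hA1 : (1 : ℝ) ≤ A := by exact_mod_cast hA0
  set C : ℝ := 8 * A / r ^ 2 + 8 * A with hC
  have hC0 : 0 < 8 * A / r ^ 2 := by positivity
  have hC1 : 1 ≤ C := by linarith
  refine ⟨C, by linarith, fun x hx => ?_⟩
  have hs0 := Real.sqrt_nonneg x
  have hss := Real.sq_sqrt hx
  set t := Real.sqrt x / r with ht
  have ht0 : 0 ≤ t := by positivity
  have htr : t * r = Real.sqrt x := by rw [ht]; field_simp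
  have htx : t ^ 2 = x / r ^ 2 := by rw [ht, div_pow, hss]
  -- With 2^i ≤ t + 1 < 2^(i+1), the exponent r · 2^(i+1) exceeds √x, while 4^(i+1) ≤ 4(t + 1)² ≤
  -- 8x/r² + 8 stays linear in x; this is the source of C.
  obtain ⟨i, hi1, hi2⟩ := exists_nat_pow_near (show (1 : ℝ) ≤ t + 1 by linarith) one_lt_two
  have h1 : Real.exp (Real.sqrt x) ≤ Real.exp (r * 2 ^ (i + 1)) := by
    apply Real.exp_le_exp.2
    nlinarith
  have h2 : 4 ^ (i + 1) * A ≤ ⌊C * x + C⌋₊ := by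
    apply Nat.le_floor
    push_cast
    have h4 : (4 : ℝ) ^ (i + 1) = 4 * (2 ^ i) ^ 2 := by
      rw [← pow_mul, mul_comm i 2, pow_mul, pow_succ]; norm_num; ring
    have h5 : ((2 : ℝ) ^ i) ^ 2 ≤ (t + 1) ^ 2 := by gcongr
    have h6 : (t + 1) ^ 2 ≤ 2 * (x / r ^ 2) + 2 := by nlinarith [sq_nonneg (t - 1)]
    have h7 : (4 : ℝ) ^ (i + 1) ≤ 8 * (x / r ^ 2) + 8 := by linarith
    calc (4 : ℝ) ^ (i + 1) * A ≤ (8 * (x / r ^ 2) + 8) * A := by gcongr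
      _ = 8 * A / r ^ 2 * x + 8 * A := by ring
      _ ≤ C * x + C := by nlinarith
  have h3 : M * (2 * (4 ^ (i + 1) * (k₀ + 1)) + 1) ≤ 4 ^ (i + 1) * A := by
    rw [hA]
    have : 1 ≤ 4 ^ (i + 1) := Nat.one_le_pow _ _ (by norm_num)
    nlinarith [Nat.mul_le_mul_left M this]
  have h4 : (altBall (4 ^ (i + 1) * (k₀ + 1))).ncard ≤ growth S ⌊C * x + C⌋₊ :=
    (hM _).trans (growth_mono hS hfin (h3.trans h2))
  have h5 : ((altBall (4 ^ (i + 1) * (k₀ + 1))).ncard : ℝ) ≤ growth S ⌊C * x + C⌋₊ := by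
    exact_mod_cast h4
  have h6 : Real.exp (Real.sqrt x) ≤ growth S ⌊C * x + C⌋₊ := h1.trans ((hk _).trans h5)
  have h7 : (0 : ℝ) ≤ growth S ⌊C * x + C⌋₊ := Nat.cast_nonneg _
  simp only [ofSeq]
  nlinarith

theorem growth_precsim {η : ℝ} (h : IsEta η) {S : Set grigorchukGroup} (hfin : S.Finite)
    (hS : IsGenSystem S) :
    Precsim (ofSeq (growth S)) (fun x => Real.exp (x ^ growthExponent η)) := by
  obtain ⟨M, hM0, hM⟩ := exists_growth_le h hfin hS
  obtain ⟨c, hc0, hc⟩ := exists_ncard_weightBall_le h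
  obtain ⟨hb0, hb1⟩ := growthExponent_mem h
  -- D moves the factor c inside the power: c y^β = (D y)^β.
  set D := c ^ (1 / growthExponent η) with hD
  have hD0 : 0 < D := by positivity
  have hDc : D ^ growthExponent η = c := by
    rw [hD, ← Real.rpow_mul hc0.le, one_div_mul_cancel hb0.ne', Real.rpow_one]
  set C := D * M + D + 1 with hC
  have hDM : 0 < D * M := by positivity
  refine ⟨C, by positivity, fun x hx => ?_⟩
  have h1 : (growth S ⌊x⌋₊ : ℝ) ≤ (weightBall η (M * ⌊x⌋₊)).ncard := by exact_mod_cast hM _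
  have h2 := hc (M * ⌊x⌋₊) (by positivity)
  have h3 : c * (M * ⌊x⌋₊ + 1) ^ growthExponent η ≤ (C * x + C) ^ growthExponent η := by
    rw [← hDc, ← Real.mul_rpow hD0.le (by positivity)]
    refine Real.rpow_le_rpow (by positivity) ?_ hb0.le
    have := mul_le_mul_of_nonneg_left (Nat.floor_le hx) hDM.le
    nlinarith
  have h4 := Real.exp_le_exp.2 h3
  have h5 := Real.exp_pos ((C * x + C) ^ growthExponent η)
  simp only [ofSeq]
  nlinarith

end GrigorchukGrowth

theorem mainTheorem9 :
    ∃ η : ℝ, (∀ x : ℝ, x ^ 3 + x ^ 2 + x - 2 = 0 ↔ x = η) ∧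
      ∀ S : Set GrigorchukGrowth.grigorchukGroup,
        S.Finite → GrigorchukGrowth.IsGenSystem S →
          GrigorchukGrowth.Precsim (fun x => Real.exp (Real.sqrt x))
              (GrigorchukGrowth.ofSeq (GrigorchukGrowth.growth S)) ∧
            GrigorchukGrowth.Precsim (GrigorchukGrowth.ofSeq (GrigorchukGrowth.growth S))
              (fun x => Real.exp (x ^ (1 / (1 - Real.logb 2 η)))) := by
  obtain ⟨η, h⟩ := GrigorchukGrowth.exists_isEta
  exact ⟨η, h.root_iff, fun S hfin hS =>
    ⟨GrigorchukGrowth.precsim_growth hfin hS, GrigorchukGrowth.growth_precsim h hfin hS⟩⟩
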